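/- **Theorem.** Let $p$ be any prime number and let $A=\mathbb Z\{X,Y\}$ be the free non-commutative ring on $X$ and $Y$. There is no continuous surjective group homomorphism $\Phi: W(A)\to HH_0(E(A))$ that is compatible with the Verschiebung $V$ and the Teichmüller map $\langle\cdot\rangle$, in the following sense. For a ring $R$, $[R,R]$ denotes the additive subgroup generated by all $xy-yx$. $\mathbb N_0=\{0,1,2,\dots\}$. *The group $W(A)$ (Hesselholt).* For a unital ring $R$ and $a\in R^{\mathbb N_0}$ put $\omega_i(a)=\sum_{j=0}^{i}p^ja_j^{p^{i-j}}$, and let $\omega: R^n\to (R/[R,R])^n$ be the map with components $\omega_0,\dots,\omega_{n-1}$. If $F$ is a free (non-commutative) ring, $W_n(F)\subset (F/[F,F])^n$ is the subgroup given by the image of $\omega$. For any unital ring $A$, let $F\to A$ be the canonical surjection from the free ring on the set $A$; $W_n(A)$ is the quotient of $W_n(F)$ by the subgroup generated by all $\omega(a)-\omega(b)$ with $a,b\in F^n$ having the same image in $A^n$. There is an induced surjective map $q_n:A^n\to W_n(A)$. If $A$ is itself free, this is again the image of $\omega$ in $(A/[A,A])^n$. Put $W(A)=\varprojlim_n W_n(A)$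 with the inverse limit topology of the discrete groups $W_n(A)$, and write $(a_0,a_1,\dots)$ for the element with components $q_n(a_0,\dots,a_{n-1})$. Then $\langle a\rangle=(a,0,0,\dots)$ and $V$ is the additive operator with $V(a_0,a_1,\dots)=(0,a_0,a_1,\dots)$. *The ring $E(A)$ (Cuntz–Deninger).* For a unital ring $R$ give $R^{\mathbb N_0}$ the product of the discrete topologies, put $V(a_0,a_1,\dots)=p\,(0,a_0,a_1,\dots)$ and $\langle a\rangle=(a,a^p,a^{p^2},\dots)$. Let $X(R)$ be the closed subgroup (it is a subring) generated by all $V^m(\langle a_1\rangle\cdots\langle a_r\rangle)$ with $m\ge 0$, $r\ge 1$, $a_i\in R$; for a two-sided ideal $I$ of $R$ let $X(I)\subset X(R)$ be the closed subgroup (it is a two-sided ideal) generated by those $V^m(\langle a_1\rangle\cdots\langle a_r\rangle)$ for which at least one $a_i$ lies in $I$. Let $\mathbb ZA$ be the monoid algebra of the multiplicative monoid of $A$ and $I$ the kernel of $\mathbb ZA\to A$, $[a]\mapsto a$. Then $E(A)=X(\mathbb ZA)/X(I)$ with the quotient topology, with the induced additive operator $V$ and with $\langle a\rangle$ the class of $\langle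 [a]\rangle$. Finally $HH_0(E(A))=E(A)/\overline{[E(A),E(A)]}$ with the quotient topology; write $\pi:E(A)\to HH_0(E(A))$ for the quotient map. *Compatibility* means: $\Phi(\langle a\rangle)=\pi(\langle a\rangle)$ for all $a\in A$, and for every $w\in W(A)$ there is $e\in E(A)$ with $\Phi(w)=\pi(e)$ and $\Phi(Vw)=\pi(Ve)$. (If $V$ on $E(A)$ induces an operator $V$ on $HH_0(E(A))$, the second condition says exactly that $\Phi\circ V=V\circ\Phi$.) -/

import Mathlib

namespace NCWitt

universe u

/-! ### Commutator subgroups -/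

/-- The additive subgroup `[R, R]` of `R` generated by the commutators `x * y - y * x`
(in general not an ideal). -/
def commSubgroup (R : Type u) [Ring R] : AddSubgroup R :=
  AddSubgroup.closure {z | ∃ x y : R, z = x * y - y * x}

/-- The abelian group `R / [R, R]`. -/
abbrev Cyc (R : Type u) [Ring R] : Type u := R ⧸ commSubgroup R

/-! ### Hesselholt's group `W(A)` -/

section Hesselholt

/-- The `i`-th ghost polynomial
`ω_i(a) = a₀ ^ (p ^ i) + p a₁ ^ (p ^ (i - 1)) + ⋯ + p ^ i a_i`. -/
def ghostPoly (p : ℕ) {R : Type u} [Ring R] (a : ℕ → R) (i : ℕ) : R :=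
  ∑ j ∈ Finset.range (i + 1), (p : R) ^ j * a j ^ p ^ (i - j)

/-- The ghost map of length `n`, `a ↦ (ω_0(a), …, ω_{n-1}(a))` with values in `(R / [R, R])ⁿ`.
Only the entries `a 0, …, a (n - 1)` of `a` matter. -/
def ghostVec (p n : ℕ) {R : Type u} [Ring R] (a : ℕ → R) : Fin n → Cyc R :=
  fun i => QuotientAddGroup.mk (ghostPoly p a i)

/-- The subgroup of `(R / [R, R])ⁿ` generated by the image of the ghost map. For a free ring `R`
(more generally, whenever `R / [R, R]` has no `p`-torsion) the image is itself a subgroup, and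
this is Hesselholt's `W_n(R)` embedded by its injective ghost homomorphism. -/
def ghostGroup (p n : ℕ) (R : Type u) [Ring R] : AddSubgroup (Fin n → Cyc R) :=
  AddSubgroup.closure (Set.range (ghostVec p n))

/-- The canonical surjection from the free ring on the set `A` to the ring `A`. -/
def freeCover (A : Type u) [Ring A] : FreeRing A →+* A := FreeRing.lift id

/-- The relations that define `W_n(A)` as a quotient of `W_n` of the free ring on `A`: Witt
vectors whose coordinates have the same images in `A` are identified. -/
def ghostRel (p n : ℕ) (A : Type u) [Ring A] : AddSubgroup (ghostGroup p n (FreeRing A)) :=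
  AddSubgroup.closure {x | ∃ a b : ℕ → FreeRing A,
    (∀ j, freeCover A (a j) = freeCover A (b j)) ∧
      (x : Fin n → Cyc (FreeRing A)) = ghostVec p n a - ghostVec p n b}

/-- Hesselholt's group `W_n(A)` of `p`-typical Witt vectors of length `n`. -/
def WLen (p n : ℕ) (A : Type u) [Ring A] : Type u :=
  ghostGroup p n (FreeRing A) ⧸ ghostRel p n A

instance (p n : ℕ) (A : Type u) [Ring A] : AddCommGroup (WLen p n A) :=
  inferInstanceAs (AddCommGroup (ghostGroup p n (FreeRing A) ⧸ ghostRel p n A))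

/-- `W_n(A)` is discrete. -/
instance (p n : ℕ) (A : Type u) [Ring A] : TopologicalSpace (WLen p n A) := ⊥

/-- The map `q_n : Aⁿ → W_n(A)`, sending coordinates to the Witt vector with these coordinates. -/
def wittVec (p n : ℕ) {A : Type u} [Ring A] (a : ℕ → A) : WLen p n A :=
  QuotientAddGroup.mk ⟨ghostVec p n (fun j => FreeRing.of (a j)),
    AddSubgroup.subset_closure ⟨_, rfl⟩⟩

/-- A homomorphism of ambient groups that maps ghost vectors to ghost vectors through a map `f` of
coordinates compatible with `freeCover` induces a homomorphism of the groups `W_n(A)`. -/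
def WLen.map (p m n : ℕ) (A : Type u) [Ring A]
    (g : (Fin m → Cyc (FreeRing A)) →+ (Fin n → Cyc (FreeRing A)))
    (f : (ℕ → FreeRing A) → ℕ → FreeRing A)
    (hg : ∀ a, g (ghostVec p m a) = ghostVec p n (f a))
    (hf : ∀ a b, (∀ j, freeCover A (a j) = freeCover A (b j)) →
      ∀ j, freeCover A (f a j) = freeCover A (f b j)) :
    WLen p m A →+ WLen p n A :=
  QuotientAddGroup.map (ghostRel p m A) (ghostRel p n A)
    ((g.comp (ghostGroup p m (FreeRing A)).subtype).codRestrict (ghostGroup p n (FreeRing A))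
      (fun x => by
        have h : ghostGroup p m (FreeRing A) ≤ (ghostGroup p n (FreeRing A)).comap g := by
          refine (AddSubgroup.closure_le _).2 ?_
          rintro _ ⟨a, rfl⟩
          exact AddSubgroup.subset_closure ⟨f a, (hg a).symm⟩
        exact h x.2))
    (by
      refine (AddSubgroup.closure_le _).2 ?_
      rintro x ⟨a, b, hab, hx⟩
      refine AddSubgroup.subset_closure ⟨f a, f b, hf a b hab, ?_⟩
      change g (x : Fin m → Cyc (FreeRing A)) = _
      rw [hx, map_sub, hg, hg])

/-- The restriction homomorphism `W_{n+1}(A) → W_n(A)` that forgets the last coordinate. -/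
def WLen.res (p n : ℕ) (A : Type u) [Ring A] : WLen p (n + 1) A →+ WLen p n A :=
  WLen.map p (n + 1) n A
    { toFun := fun x i => x i.castSucc
      map_zero' := rfl
      map_add' := fun _ _ => rfl }
    id (fun _ => rfl) (fun _ _ h => h)

/-- The effect of the Verschiebung on ghost components,
`(x₀, …, x_{n-1}) ↦ (0, p x₀, …, p x_{n-2})`. -/
def ghostShift (p n : ℕ) (G : Type u) [AddCommGroup G] : (Fin n → G) →+ (Fin n → G) where
  toFun x i := if h : i.1 = 0 then 0 else p • x ⟨i.1 - 1, by omega⟩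
  map_zero' := by
    funext i
    by_cases h : i.1 = 0 <;> simp [h]
  map_add' x y := by
    funext i
    by_cases h : i.1 = 0 <;> simp [h]

/-- The shift `(a₀, a₁, …) ↦ (0, a₀, a₁, …)` of coordinates. -/
def shiftSeq {R : Type u} [Zero R] (a : ℕ → R) : ℕ → R
  | 0 => 0
  | j + 1 => a j

theorem ghostPoly_shiftSeq_zero (p : ℕ) {R : Type u} [Ring R] (a : ℕ → R) :
    ghostPoly p (shiftSeq a) 0 = 0 := by
  simp [ghostPoly, shiftSeq]

theorem ghostPoly_shiftSeq_succ (p : ℕ) [Fact p.Prime] {R : Type u} [Ring R] (a : ℕ → R) (i : ℕ) :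
    ghostPoly p (shiftSeq a) (i + 1) = p • ghostPoly p a i := by
  have hp : p ≠ 0 := (Fact.out : p.Prime).ne_zero
  unfold ghostPoly
  rw [Finset.sum_range_succ', Finset.smul_sum]
  have h0 : (shiftSeq a 0) ^ p ^ (i + 1 - 0) = 0 := zero_pow (pow_ne_zero _ hp)
  rw [h0, mul_zero, add_zero]
  refine Finset.sum_congr rfl fun j _ => ?_
  rw [Nat.add_sub_add_right, nsmul_eq_mul, pow_succ', mul_assoc]
  rfl

theorem ghostShift_ghostVec (p n : ℕ) [Fact p.Prime] {R : Type u} [Ring R] (a : ℕ → R) :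
    ghostShift p n (Cyc R) (ghostVec p n a) = ghostVec p n (shiftSeq a) := by
  funext i
  obtain ⟨i, hi⟩ := i
  cases i with
  | zero => simp [ghostShift, ghostVec, ghostPoly_shiftSeq_zero]
  | succ i =>
    simp only [ghostShift, ghostVec, AddMonoidHom.coe_mk, ZeroHom.coe_mk,
      ghostPoly_shiftSeq_succ]
    rfl

/-- The Verschiebung on `W_n(A)`, given by
`(a₀, …, a_{n-1}) ↦ (0, a₀, …, a_{n-2})` on coordinates. -/
def WLen.verschiebung (p n : ℕ) [Fact p.Prime] (A : Type u) [Ring A] : WLen p n A →+ WLen p n A :=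
  WLen.map p n n A (ghostShift p n _) shiftSeq (ghostShift_ghostVec p n) (by
    intro a b h j
    cases j with
    | zero => rfl
    | succ j => exact h j)

theorem WLen.res_verschiebung (p n : ℕ) [Fact p.Prime] (A : Type u) [Ring A]
    (x : WLen p (n + 1) A) :
    WLen.res p n A (WLen.verschiebung p (n + 1) A x) =
      WLen.verschiebung p n A (WLen.res p n A x) := by
  obtain ⟨x, rfl⟩ := QuotientAddGroup.mk_surjective x
  rfl

/-- Hesselholt's group `W(A)`, the inverse limit of the groups `W_n(A)`. -/
def wittLim (p : ℕ) (A : Type u) [Ring A] : AddSubgroup (∀ n, WLen p n A) where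
  carrier := {x | ∀ n, WLen.res p n A (x (n + 1)) = x n}
  zero_mem' := fun _ => map_zero _
  add_mem' := fun hx hy n => by
    rw [Pi.add_apply, Pi.add_apply, map_add, hx n, hy n]
  neg_mem' := fun hx n => by
    rw [Pi.neg_apply, Pi.neg_apply, map_neg, hx n]

/-- `W(A)` with its group structure and the inverse limit topology, i.e. the subspace topology
from the product of the discrete groups `W_n(A)`. -/
abbrev HW (p : ℕ) (A : Type u) [Ring A] : Type u := wittLim p A

/-- The map `q : A^{ℕ₀} → W(A)`. -/
def HW.mk (p : ℕ) {A : Type u} [Ring A] (a : ℕ → A) : HW p A :=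
  ⟨fun n => wittVec p n a, fun _ => rfl⟩

/-- The Teichmüller map `⟨a⟩ = (a, 0, 0, …)` of `W(A)`. -/
def HW.teich (p : ℕ) {A : Type u} [Ring A] (a : A) : HW p A :=
  HW.mk p (fun j => if j = 0 then a else 0)

/-- The Verschiebung `V` of `W(A)`. -/
def HW.verschiebung (p : ℕ) [Fact p.Prime] (A : Type u) [Ring A] : HW p A →+ HW p A where
  toFun x := ⟨fun n => WLen.verschiebung p n A (x.1 n), fun n => by
    rw [WLen.res_verschiebung, x.2 n]⟩
  map_zero' := by
    apply Subtype.ext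
    funext n
    exact map_zero (WLen.verschiebung p n A)
  map_add' x y := by
    apply Subtype.ext
    funext n
    exact map_add (WLen.verschiebung p n A) _ _

/-- `V` is the shift `(a₀, a₁, …) ↦ (0, a₀, a₁, …)` on coordinates. -/
theorem HW.verschiebung_mk (p : ℕ) [Fact p.Prime] {A : Type u} [Ring A] (a : ℕ → A) :
    HW.verschiebung p A (HW.mk p a) = HW.mk p (shiftSeq a) := by
  apply Subtype.ext
  funext n
  refine QuotientAddGroup.eq_iff_sub_mem.2 (AddSubgroup.subset_closure
    ⟨shiftSeq (fun j => FreeRing.of (a j)), fun j => FreeRing.of (shiftSeq a j), ?_, ?_⟩)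
  · intro j
    cases j with
    | zero => simp [shiftSeq, freeCover]
    | succ j => rfl
  · rw [← ghostShift_ghostVec]
    rfl

end Hesselholt

/-! ### The ring `E(A)` of Cuntz and Deninger -/

noncomputable section CuntzDeninger

/-- The product ring `R^{ℕ₀}`, to be endowed with the product of the discrete topologies. -/
def Seq (R : Type u) : Type u := ℕ → R

instance (R : Type u) [Ring R] : Ring (Seq R) := inferInstanceAs (Ring (ℕ → R))

instance (R : Type u) : TopologicalSpace (Seq R) :=
  @Pi.topologicalSpace ℕ (fun _ => R) (fun _ => ⊥)

instance (R : Type u) [Ring R] : IsTopologicalRing (Seq R) := by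
  let _ : TopologicalSpace R := ⊥
  have _ : DiscreteTopology R := ⟨rfl⟩
  exact inferInstanceAs (IsTopologicalRing (ℕ → R))

/-- `V(a₀, a₁, …) = p (0, a₀, a₁, …)` on `R^{ℕ₀}`. -/
def Seq.V (p : ℕ) (R : Type u) [Ring R] : Seq R →+ Seq R where
  toFun x := fun n => if n = 0 then 0 else (p : R) * x (n - 1)
  map_zero' := by
    funext n
    change (if n = 0 then 0 else (p : R) * (0 : R)) = 0
    simp
  map_add' x y := by
    funext n
    change (if n = 0 then 0 else (p : R) * (x (n - 1) + y (n - 1))) =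
      (if n = 0 then 0 else (p : R) * x (n - 1)) + (if n = 0 then 0 else (p : R) * y (n - 1))
    split_ifs
    · simp
    · exact mul_add _ _ _

/-- `⟨a⟩ = (a, a ^ p, a ^ (p ^ 2), …)` in `R^{ℕ₀}`. -/
def Seq.teich (p : ℕ) {R : Type u} [Ring R] (a : R) : Seq R := fun n => a ^ p ^ n

/-- The shift `(a₀, a₁, …) ↦ (a₁, a₂, …)`. -/
def Seq.F (R : Type u) [Ring R] : Seq R →+* Seq R where
  toFun x := fun n => x (n + 1)
  map_one' := rfl
  map_mul' _ _ := rfl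
  map_zero' := rfl
  map_add' _ _ := rfl

/-- The elements `V^m(⟨a₁⟩ ⋯ ⟨a_r⟩)`, `m ≥ 0`, `r ≥ 1`, with all `a_i` in `R` and at least one of
them in `S`. For `S = R` the last condition only says that `r ≥ 1`. -/
def XGens (p : ℕ) {R : Type u} [Ring R] (S : Set R) : Set (Seq R) :=
  {x | ∃ (m : ℕ) (l : List R), (∃ a ∈ l, a ∈ S) ∧
    x = (Seq.V p R)^[m] (l.map (Seq.teich p)).prod}

/-- The closed subgroup of `R^{ℕ₀}` generated by `XGens p S`. -/
def XGroup (p : ℕ) {R : Type u} [Ring R] (S : Set R) : AddSubgroup (Seq R) :=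
  (AddSubgroup.closure (XGens p S)).topologicalClosure

theorem Seq.V_mul (p : ℕ) {R : Type u} [Ring R] (x y : Seq R) :
    Seq.V p R x * y = Seq.V p R (x * Seq.F R y) := by
  funext n
  change (if n = 0 then 0 else (p : R) * x (n - 1)) * y n =
    if n = 0 then 0 else (p : R) * (x (n - 1) * y (n - 1 + 1))
  rcases n with _ | n
  · simp
  · simp [mul_assoc]

theorem Seq.mul_V (p : ℕ) {R : Type u} [Ring R] (x y : Seq R) :
    x * Seq.V p R y = Seq.V p R (Seq.F R x * y) := by
  funext n
  change x n * (if n = 0 then 0 else (p : R) * y (n - 1)) =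
    if n = 0 then 0 else (p : R) * (x (n - 1 + 1) * y (n - 1))
  rcases n with _ | n
  · simp
  · simp only [Nat.add_sub_cancel, Nat.succ_ne_zero, if_false]
    rw [← mul_assoc, ← mul_assoc, (Nat.cast_commute p (x (n + 1))).eq]

theorem Seq.F_V (p : ℕ) {R : Type u} [Ring R] (x : Seq R) :
    Seq.F R (Seq.V p R x) = p • x := by
  funext n
  change (if n + 1 = 0 then 0 else (p : R) * x (n + 1 - 1)) = p • x n
  simp

theorem Seq.F_prod (p : ℕ) {R : Type u} [Ring R] (l : List R) :
    Seq.F R (l.map (Seq.teich p)).prod = ((l.map (· ^ p)).map (Seq.teich p)).prod := by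
  rw [map_list_prod, List.map_map, List.map_map]
  congr 1
  refine List.map_congr_left fun a _ => ?_
  funext n
  change a ^ p ^ (n + 1) = (a ^ p) ^ p ^ n
  rw [← pow_mul, pow_succ']

theorem Seq.V_mem_closure (p : ℕ) {R : Type u} [Ring R] {S : Set R} {x : Seq R}
    (hx : x ∈ AddSubgroup.closure (XGens p S)) :
    Seq.V p R x ∈ AddSubgroup.closure (XGens p S) := by
  have h : AddSubgroup.closure (XGens p S) ≤
      (AddSubgroup.closure (XGens p S)).comap (Seq.V p R) := by
    refine (AddSubgroup.closure_le _).2 ?_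
    rintro _ ⟨m, l, hl, rfl⟩
    refine AddSubgroup.subset_closure ⟨m + 1, l, hl, ?_⟩
    rw [Function.iterate_succ_apply']
  exact h hx

theorem Seq.gen_mul_gen (p : ℕ) (hp : p ≠ 0) {R : Type u} [Ring R] (I : Ideal R) :
    ∀ (m n : ℕ) (l k : List R), (∃ a ∈ l ++ k, a ∈ I) →
      (Seq.V p R)^[m] (l.map (Seq.teich p)).prod * (Seq.V p R)^[n] (k.map (Seq.teich p)).prod ∈
        AddSubgroup.closure (XGens p (I : Set R)) := by
  have hpow : ∀ l : List R, (∃ a ∈ l, a ∈ I) → ∃ a ∈ l.map (· ^ p), a ∈ I := by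
    rintro l ⟨a, ha, haI⟩
    exact ⟨a ^ p, List.mem_map.2 ⟨a, ha, rfl⟩, I.pow_mem_of_mem haI p (Nat.pos_of_ne_zero hp)⟩
  intro m
  induction m with
  | zero =>
    intro n
    induction n with
    | zero =>
      intro l k h
      refine AddSubgroup.subset_closure ⟨0, l ++ k, h, ?_⟩
      simp
    | succ n ih =>
      intro l k h
      rw [Function.iterate_succ_apply', Seq.mul_V]
      apply Seq.V_mem_closure
      rw [Function.iterate_zero, id, Seq.F_prod]
      refine ih (l.map (· ^ p)) k ?_
      obtain ⟨a, ha, haI⟩ := h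
      rcases List.mem_append.1 ha with ha | ha
      · obtain ⟨b, hb, hbI⟩ := hpow l ⟨a, ha, haI⟩
        exact ⟨b, List.mem_append_left _ hb, hbI⟩
      · exact ⟨a, List.mem_append_right _ ha, haI⟩
  | succ m ih =>
    intro n l k h
    rw [Function.iterate_succ_apply', Seq.V_mul]
    apply Seq.V_mem_closure
    cases n with
    | zero =>
      rw [Function.iterate_zero, id, Seq.F_prod]
      refine ih 0 l (k.map (· ^ p)) ?_
      obtain ⟨a, ha, haI⟩ := h
      rcases List.mem_append.1 ha with ha | ha
      · exact ⟨a, List.mem_append_left _ ha, haI⟩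
      · obtain ⟨b, hb, hbI⟩ := hpow k ⟨a, ha, haI⟩
        exact ⟨b, List.mem_append_right _ hb, hbI⟩
    | succ n =>
      rw [Function.iterate_succ_apply', Seq.F_V, mul_smul_comm]
      exact AddSubgroup.nsmul_mem _ (ih n l k h) p

theorem XGroup_mul_mem (p : ℕ) (hp : p ≠ 0) {R : Type u} [Ring R] (I S T : Ideal R)
    (h : S ≤ I ∨ T ≤ I) {x y : Seq R}
    (hx : x ∈ XGroup p (S : Set R)) (hy : y ∈ XGroup p (T : Set R)) :
    x * y ∈ XGroup p (I : Set R) := by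
  refine map_mem_closure₂ continuous_mul hx hy ?_
  intro x hx y hy
  change x * y ∈ AddSubgroup.closure (XGens p (I : Set R))
  induction hx using AddSubgroup.closure_induction with
  | mem x hx =>
    obtain ⟨m, l, ⟨a, ha, haS⟩, rfl⟩ := hx
    induction hy using AddSubgroup.closure_induction with
    | mem y hy =>
      obtain ⟨n, k, ⟨b, hb, hbT⟩, rfl⟩ := hy
      refine Seq.gen_mul_gen p hp I m n l k ?_
      rcases h with h | h
      · exact ⟨a, List.mem_append_left _ ha, h haS⟩
      · exact ⟨b, List.mem_append_right _ hb, h hbT⟩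
    | zero => rw [mul_zero]; exact zero_mem _
    | add y z _ _ h₁ h₂ => rw [mul_add]; exact add_mem h₁ h₂
    | neg y _ h => rw [mul_neg]; exact neg_mem h
  | zero => rw [zero_mul]; exact zero_mem _
  | add x y _ _ h₁ h₂ => rw [add_mul]; exact add_mem h₁ h₂
  | neg x _ h => rw [neg_mul]; exact neg_mem h

theorem Seq.continuous_V (p : ℕ) (R : Type u) [Ring R] : Continuous (Seq.V p R) := by
  let _ : TopologicalSpace R := ⊥
  have _ : DiscreteTopology R := ⟨rfl⟩
  refine @continuous_pi (Seq R) ℕ (fun _ => R) _ _ _ fun n => ?_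
  have h : Continuous fun x : Seq R => x (n - 1) :=
    @continuous_apply ℕ (fun _ => R) _ (n - 1)
  exact (continuous_of_discreteTopology
    (f := fun r : R => if n = 0 then 0 else (p : R) * r)).comp h

theorem XGroup_V_mem (p : ℕ) {R : Type u} [Ring R] {S : Set R} {x : Seq R}
    (hx : x ∈ XGroup p S) : Seq.V p R x ∈ XGroup p S :=
  map_mem_closure (Seq.continuous_V p R) hx fun _ h => Seq.V_mem_closure p h

/-- The ring `X(R)`: the closed subgroup of `R^{ℕ₀}` generated by all
`V^m(⟨a₁⟩ ⋯ ⟨a_r⟩)`, which is a subring. -/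
def X (p : ℕ) [Fact p.Prime] (R : Type u) [Ring R] : Subring (Seq R) where
  carrier := XGroup p (Set.univ : Set R)
  mul_mem' := fun hx hy =>
    XGroup_mul_mem p (Fact.out : p.Prime).ne_zero ⊤ ⊤ ⊤ (Or.inl le_rfl) hx hy
  one_mem' := by
    refine AddSubgroup.le_topologicalClosure _ (AddSubgroup.subset_closure
      ⟨0, [1], ⟨1, List.mem_singleton_self _, trivial⟩, ?_⟩)
    funext n
    change (1 : R) = ([(1 : R)].map (Seq.teich p)).prod n
    rw [List.map_singleton, List.prod_singleton]
    exact (one_pow _).symm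
  add_mem' := fun hx hy => add_mem hx hy
  zero_mem' := zero_mem (XGroup p (Set.univ : Set R))
  neg_mem' := fun hx => neg_mem hx

theorem XGroup_le_X (p : ℕ) [Fact p.Prime] {R : Type u} [Ring R] (S : Set R) :
    XGroup p S ≤ (X p R).toAddSubgroup :=
  AddSubgroup.topologicalClosure_mono (AddSubgroup.closure_mono
    fun _ ⟨m, l, ⟨a, ha, _⟩, h⟩ => ⟨m, l, ⟨a, ha, trivial⟩, h⟩)

/-- For a two-sided ideal `I` of `R`, the closed two-sided ideal `X(I)` of `X(R)`: the closed
subgroup generated by the `V^m(⟨a₁⟩ ⋯ ⟨a_r⟩)` with all `a_i` in `R` and at least one `a_i` in `I`.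
It is the smallest closed two-sided ideal that is stable under `V` and contains `⟨a⟩` for `a` in
`I`. -/
def XIdeal (p : ℕ) [Fact p.Prime] {R : Type u} [Ring R] (I : Ideal R) : Ideal (X p R) where
  carrier := {x | (x : Seq R) ∈ XGroup p (I : Set R)}
  add_mem' := fun hx hy => (XGroup p (I : Set R)).add_mem hx hy
  zero_mem' := zero_mem (XGroup p (I : Set R))
  smul_mem' := fun c _ hx =>
    XGroup_mul_mem p (Fact.out : p.Prime).ne_zero I ⊤ I (Or.inr le_rfl) c.2 hx

instance (p : ℕ) [Fact p.Prime] {R : Type u} [Ring R] (I : Ideal R) :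
    (XIdeal p I).IsTwoSided where
  mul_mem_of_left := fun {a} b (hx : (a : Seq R) ∈ XGroup p (I : Set R)) => by
    have h : (a : Seq R) * (b : Seq R) ∈ XGroup p (I : Set R) :=
      XGroup_mul_mem p (Fact.out : p.Prime).ne_zero I I ⊤ (Or.inl le_rfl) hx b.2
    exact h

/-- `V` on `X(R)`. -/
def X.V (p : ℕ) [Fact p.Prime] (R : Type u) [Ring R] : X p R →+ X p R where
  toFun x := ⟨Seq.V p R x, XGroup_V_mem p x.2⟩
  map_zero' := Subtype.ext (map_zero (Seq.V p R))
  map_add' x y := Subtype.ext (map_add (Seq.V p R) (x : Seq R) y)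

/-- The Teichmüller element `⟨a⟩` of `X(R)`. -/
def X.teich (p : ℕ) [Fact p.Prime] {R : Type u} [Ring R] (a : R) : X p R :=
  ⟨Seq.teich p a, AddSubgroup.le_topologicalClosure _ (AddSubgroup.subset_closure
    ⟨0, [a], ⟨a, List.mem_singleton_self _, trivial⟩, by simp⟩)⟩

/-- The canonical surjection `ℤA → A`, `[a] ↦ a`, where `ℤA` is the monoid algebra of the
multiplicative monoid of `A`. -/
def monoidCover (A : Type u) [Ring A] : MonoidAlgebra ℤ A →+* A :=
  (MonoidAlgebra.lift ℤ A A (MonoidHom.id A)).toRingHom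

/-- The ring `E(A) = X(ℤA) / X(I)`, where `I` is the kernel of `ℤA → A`. -/
def E (p : ℕ) [Fact p.Prime] (A : Type u) [Ring A] : Type u :=
  X p (MonoidAlgebra ℤ A) ⧸ XIdeal p (RingHom.ker (monoidCover A))

instance (p : ℕ) [Fact p.Prime] (A : Type u) [Ring A] : Ring (E p A) :=
  inferInstanceAs (Ring (X p (MonoidAlgebra ℤ A) ⧸ XIdeal p (RingHom.ker (monoidCover A))))

/-- The quotient map `X(ℤA) → E(A)`. -/
def E.mk (p : ℕ) [Fact p.Prime] (A : Type u) [Ring A] : X p (MonoidAlgebra ℤ A) →+* E p A :=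
  Ideal.Quotient.mk (XIdeal p (RingHom.ker (monoidCover A)))

/-- `E(A)` carries the quotient topology. -/
instance (p : ℕ) [Fact p.Prime] (A : Type u) [Ring A] : TopologicalSpace (E p A) :=
  TopologicalSpace.coinduced (E.mk p A) inferInstance

instance (p : ℕ) [Fact p.Prime] (A : Type u) [Ring A] : IsTopologicalAddGroup (E p A) :=
  inferInstanceAs (IsTopologicalAddGroup (X p (MonoidAlgebra ℤ A) ⧸
    (XIdeal p (RingHom.ker (monoidCover A))).toAddSubgroup))

/-- The Teichmüller map `A → E(A)`, `a ↦ ([a], [a] ^ p, [a] ^ (p ^ 2), …) mod X(I)`. -/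
def E.teich (p : ℕ) [Fact p.Prime] {A : Type u} [Ring A] (a : A) : E p A :=
  E.mk p A (X.teich p (MonoidAlgebra.of ℤ A a))

/-- The Verschiebung `V` of `E(A)`. -/
def E.V (p : ℕ) [Fact p.Prime] (A : Type u) [Ring A] : E p A →+ E p A :=
  QuotientAddGroup.map (XIdeal p (RingHom.ker (monoidCover A))).toAddSubgroup
    (XIdeal p (RingHom.ker (monoidCover A))).toAddSubgroup (X.V p (MonoidAlgebra ℤ A))
    (fun x (hx : (x : Seq (MonoidAlgebra ℤ A)) ∈
        XGroup p (RingHom.ker (monoidCover A) : Set (MonoidAlgebra ℤ A))) => by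
      have h := XGroup_V_mem p hx
      exact h)

theorem E.V_mk (p : ℕ) [Fact p.Prime] (A : Type u) [Ring A] (x : X p (MonoidAlgebra ℤ A)) :
    E.V p A (E.mk p A x) = E.mk p A (X.V p (MonoidAlgebra ℤ A) x) := rfl

/-- `HH₀(R)`, the quotient of the additive group of a topological ring `R` by the closure of
`[R, R]`, with the quotient topology. -/
abbrev HH0 (R : Type u) [Ring R] [TopologicalSpace R] [IsTopologicalAddGroup R] : Type u :=
  R ⧸ (commSubgroup R).topologicalClosure

/-- The quotient map `R → HH₀(R)`. -/
def HH0.mk (R : Type u) [Ring R] [TopologicalSpace R] [IsTopologicalAddGroup R] : R →+ HH0 R :=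
  QuotientAddGroup.mk' (commSubgroup R).topologicalClosure

end CuntzDeninger

end NCWitt

namespace NCWitt

universe u

/-! ### Generators of `W(A)` -/

section Hesselholt

/-! The obstruction is that `E(A)` contains products such as `⟨X⟩⟨Y⟩`, while `W(A)` is topologically
generated by Teichmüller elements and the image of `V`. A functional on `HH₀(E(A))` that kills all
`⟨a⟩` and every `V e`, but not `⟨X⟩⟨Y⟩`, therefore excludes `Φ`.

Such a functional is `x ↦ τ(x₁) - τ(x₀)` with values in `𝔽_p`, where `τ` is the trace of the
representation `X ↦ E₀₁`, `Y ↦ E₁₀` over `𝔽_p`. It is well defined and continuous, since it depends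
on two components modulo `I`. It vanishes on commutators because `τ` is a trace, on `V e` because
`(V e)₀ = 0` and `(V e)₁ = p e₀`, and on `⟨a⟩` because `tr(M ^ p) = tr(M) ^ p = tr(M)` over `𝔽_p`.
On `⟨X⟩⟨Y⟩` its value is `τ(X ^ p Y ^ p) - τ(X Y) = 0 - 1`.

On the Witt side, `HW.hom_eq_zero` shows that the composite of this functional with `Φ` is zero,
which contradicts surjectivity. The properties of the functional are the `E.diffHom` lemmas together
with `unitTrace_pow` and the two evaluations of `unitTrace`. -/

theorem wittVec_freeCover (p n : ℕ) {A : Type u} [Ring A] (b : ℕ → FreeRing A) :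
    wittVec p n (fun j => freeCover A (b j)) =
      (QuotientAddGroup.mk ⟨ghostVec p n b, AddSubgroup.subset_closure ⟨_, rfl⟩⟩ :
        ghostGroup p n (FreeRing A) ⧸ ghostRel p n A) :=
  -- `FreeRing.of (freeCover A (b j))` and `b j` have the same image in `A`, so the difference of
  -- the ghost vectors is a defining relation. Hence any lift of the coordinates may be used.
  QuotientAddGroup.eq_iff_sub_mem.2 (AddSubgroup.subset_closure
    ⟨_, b, fun j => by simp [freeCover], rfl⟩)

/-- The two coordinate sequences on the right have disjoint supports, so in each summand one of the
two terms is a positive power of `0`; no Witt addition polynomials are needed. -/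
theorem ghostPoly_eq_add (p : ℕ) [Fact p.Prime] {R : Type u} [Ring R] (a : ℕ → R) (i : ℕ) :
    ghostPoly p a i = ghostPoly p (fun j => if j = 0 then a 0 else 0) i +
      ghostPoly p (shiftSeq fun j => a (j + 1)) i := by
  have hp : ∀ k, p ^ k ≠ 0 := fun k => pow_ne_zero k (Fact.out : p.Prime).ne_zero
  unfold ghostPoly
  rw [← Finset.sum_add_distrib]
  refine Finset.sum_congr rfl fun j _ => ?_
  cases j <;> simp [shiftSeq, zero_pow (hp _)]

theorem ghostVec_eq_add (p n : ℕ) [Fact p.Prime] {R : Type u} [Ring R] (a : ℕ → R) :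
    ghostVec p n a = ghostVec p n (fun j => if j = 0 then a 0 else 0) +
      ghostVec p n (shiftSeq fun j => a (j + 1)) := by
  funext i
  exact congrArg (QuotientAddGroup.mk (s := commSubgroup R)) (ghostPoly_eq_add p a i)

/-- `(a₀, a₁, …) = ⟨a₀⟩ + V(a₁, a₂, …)` in `W(A)`. -/
theorem HW.mk_eq_teich_add_verschiebung (p : ℕ) [Fact p.Prime] {A : Type u} [Ring A]
    (a : ℕ → A) :
    HW.mk p a = HW.teich p (a 0) + HW.verschiebung p A (HW.mk p fun j => a (j + 1)) := by
  rw [HW.verschiebung_mk]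
  apply Subtype.ext
  funext n
  change wittVec p n a = wittVec p n (fun j => if j = 0 then a 0 else 0) +
    wittVec p n (shiftSeq fun j => a (j + 1))
  -- The lifts chosen below have entry `0` where the coordinate is forced to vanish, rather than the
  -- free generator `FreeRing.of 0`; only then does the ghost identity for `b` apply.
  set b : ℕ → FreeRing A := fun j => FreeRing.of (a j) with hb
  have h₁ : a = fun j => freeCover A (b j) := by
    funext j
    simp [hb, freeCover]
  have h₂ : (fun j => if j = 0 then a 0 else 0) =
      fun j => freeCover A (if j = 0 then b 0 else 0) := by
    funext j
    split_ifs <;> simp [hb, freeCover]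
  have h₃ : (shiftSeq fun j => a (j + 1)) =
      fun j => freeCover A (shiftSeq (fun j => b (j + 1)) j) := by
    funext j
    cases j <;> simp [hb, freeCover, shiftSeq]
  rw [h₂, h₃, wittVec_freeCover, wittVec_freeCover]
  conv_lhs => rw [h₁, wittVec_freeCover]
  refine congrArg QuotientAddGroup.mk (Subtype.ext ?_)
  exact ghostVec_eq_add p n b

/-- The Witt vectors with given coordinates generate `W_n(A)`. -/
theorem closure_range_wittVec (p n : ℕ) (A : Type u) [Ring A] :
    AddSubgroup.closure (Set.range (wittVec p n (A := A))) = ⊤ := by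
  rw [eq_top_iff]
  rintro x -
  obtain ⟨⟨x, hx⟩, rfl⟩ := QuotientAddGroup.mk_surjective x
  induction hx using AddSubgroup.closure_induction with
  | mem x hx =>
    obtain ⟨b, rfl⟩ := hx
    exact AddSubgroup.subset_closure ⟨_, wittVec_freeCover p n b⟩
  | zero => exact zero_mem (AddSubgroup.closure (Set.range (wittVec p n (A := A))))
  | add x y hx hy h₁ h₂ => exact add_mem h₁ h₂
  | neg x hx h => exact neg_mem h

theorem HW.apply_eq_zero_of_le {p : ℕ} {A : Type u} [Ring A] {x : HW p A} {m n : ℕ}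
    (hmn : m ≤ n) (hx : x.1 n = 0) : x.1 m = 0 := by
  induction n, hmn using Nat.le_induction with
  | base => exact hx
  | succ n _ ih => exact ih (by rw [← x.2 n, hx, map_zero])

/-- The elements of `W(A)` that vanish in `W_n(A)` for large `n` form a basis of neighbourhoods
of zero. -/
theorem HW.exists_forall_mem_of_mem_nhds {p : ℕ} {A : Type u} [Ring A] {U : Set (HW p A)}
    (hU : U ∈ nhds 0) : ∃ n, ∀ x : HW p A, x.1 n = 0 → x ∈ U := by
  obtain ⟨S, hS, hSU⟩ := mem_nhds_subtype _ _ _ |>.1 hU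
  rw [nhds_pi, Filter.mem_pi] at hS
  obtain ⟨I, hI, t, ht, htS⟩ := hS
  obtain ⟨n, hn⟩ := hI.bddAbove
  refine ⟨n, fun x hx => hSU (htS fun i hi => ?_)⟩
  rw [HW.apply_eq_zero_of_le (hn hi) hx]
  exact mem_of_mem_nhds (ht i)

/-- A continuous homomorphism from `W(A)` to a discrete group vanishes as soon as it kills the
Teichmüller elements and the image of the Verschiebung. -/
theorem HW.hom_eq_zero {p : ℕ} [Fact p.Prime] {A : Type u} [Ring A] {G : Type*} [AddGroup G]
    [TopologicalSpace G] [DiscreteTopology G] (f : HW p A →+ G) (hf : Continuous f)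
    (hteich : ∀ a, f (HW.teich p a) = 0) (hV : ∀ w, f (HW.verschiebung p A w) = 0) : f = 0 := by
  have hmk : ∀ a, f (HW.mk p a) = 0 := fun a => by
    rw [HW.mk_eq_teich_add_verschiebung, map_add, hteich, hV, add_zero]
  -- As `{0}` is open in `G`, `f` kills the kernel of the projection to some `W_n(A)`.
  obtain ⟨n, hn⟩ := HW.exists_forall_mem_of_mem_nhds
    (hf.continuousAt.preimage_mem_nhds (show {0} ∈ nhds (f 0) by simp))
  -- The classes in `W_n(A)` with a lift in the kernel of `f` form a subgroup, and it contains the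
  -- generators `q_n(a)`, which lift to `HW.mk p a`.
  have key : ∀ y ∈ AddSubgroup.closure (Set.range (wittVec p n (A := A))),
      ∃ x : HW p A, x.1 n = y ∧ f x = 0 := by
    intro y hy
    induction hy using AddSubgroup.closure_induction with
    | mem y hy =>
      obtain ⟨a, rfl⟩ := hy
      exact ⟨HW.mk p a, rfl, hmk a⟩
    | zero => exact ⟨0, rfl, map_zero f⟩
    | add y z _ _ h₁ h₂ =>
      obtain ⟨x₁, rfl, h₁⟩ := h₁
      obtain ⟨x₂, rfl, h₂⟩ := h₂
      exact ⟨x₁ + x₂, rfl, by rw [map_add, h₁, h₂, add_zero]⟩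
    | neg y _ h =>
      obtain ⟨x, rfl, h⟩ := h
      exact ⟨-x, rfl, by rw [map_neg, h, neg_zero]⟩
  ext w
  obtain ⟨x, hxw, hx⟩ := key (w.1 n) (by rw [closure_range_wittVec]; trivial)
  -- `w` and its lift `x` from the kernel agree in `W_n(A)`, so `f` does not see their difference.
  have hwx : f (w - x) = 0 := hn (w - x) (by
    change w.1 n - x.1 n = 0
    rw [hxw, sub_self])
  rwa [map_sub, hx, sub_zero] at hwx

end Hesselholt

/-! ### Trace functionals on `E(A)` -/

noncomputable section CuntzDeninger

variable {p : ℕ} [Fact p.Prime]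

/-- Each factor of the product is discrete, so no condition on `f` is required. -/
theorem Seq.continuous_apply {R : Type u} {G : Type*} [TopologicalSpace G] (f : R → G) (n : ℕ) :
    Continuous fun x : Seq R => f (x n) := by
  let _ : TopologicalSpace R := ⊥
  have _ : DiscreteTopology R := ⟨rfl⟩
  exact (continuous_of_discreteTopology (f := f)).comp (_root_.continuous_apply n)

/-- The components of an element of `X(I)` lie in `I`. -/
theorem XGroup_apply_mem {R : Type u} [Ring R] (I : Ideal R) [I.IsTwoSided] {x : Seq R}
    (hx : x ∈ XGroup p (I : Set R)) (n : ℕ) : x n ∈ I := by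
  have hclosed : IsClosed {x : Seq R | x n ∈ I} := by
    -- Membership of the `n`-th component in `I` is a function of one discrete coordinate, hence
    -- locally constant; this makes the condition closed.
    let _ : TopologicalSpace Prop := ⊥
    have _ : DiscreteTopology Prop := ⟨rfl⟩
    convert (isClosed_discrete {True}).preimage (Seq.continuous_apply (· ∈ I) n) using 1
    ext x
    simp
  have hV : ∀ x : Seq R, (∀ n, x n ∈ I) → ∀ n, Seq.V p R x n ∈ I := by
    intro x hx n
    change (if n = 0 then 0 else (p : R) * x (n - 1)) ∈ I
    split_ifs
    · exact I.zero_mem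
    · exact I.mul_mem_left _ (hx _)
  have hprod : ∀ l : List R, (∃ a ∈ l, a ∈ I) → ∀ n, (l.map (Seq.teich p)).prod n ∈ I := by
    rintro l ⟨a, ha, haI⟩ n
    induction l with
    | nil => simp at ha
    | cons b l ih =>
      rw [List.map_cons, List.prod_cons]
      change b ^ p ^ n * _ ∈ I
      rcases List.mem_cons.1 ha with rfl | ha
      · exact I.mul_mem_right _
          (I.pow_mem_of_mem haI _ (pow_pos (Fact.out : p.Prime).pos n))
      · exact I.mul_mem_left _ (ih ha)
  refine closure_minimal (fun y hy => ?_) hclosed hx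
  change y ∈ AddSubgroup.closure (XGens p (I : Set R)) at hy
  change y n ∈ I
  induction hy using AddSubgroup.closure_induction with
  | mem y hy =>
    obtain ⟨m, l, hl, rfl⟩ := hy
    clear hclosed
    induction m generalizing n with
    | zero => exact hprod l hl n
    | succ m ih =>
      rw [Function.iterate_succ_apply']
      exact hV _ ih n
  | zero => exact I.zero_mem
  | add y z _ _ h₁ h₂ => exact I.add_mem h₁ h₂
  | neg y _ h => exact I.neg_mem h

/-- The homomorphism `x ↦ f(x₁) - f(x₀)` on `E(A)` attached to a homomorphism `f` on `A`. -/
def E.diffHom (p : ℕ) [Fact p.Prime] {A : Type u} [Ring A] {G : Type*} [AddCommGroup G]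
    (f : A →+ G) : E p A →+ G :=
  QuotientAddGroup.lift (XIdeal p (RingHom.ker (monoidCover A))).toAddSubgroup
    { toFun := fun x => f (monoidCover A (x.1 1)) - f (monoidCover A (x.1 0))
      map_zero' := by
        change f (monoidCover A 0) - f (monoidCover A 0) = 0
        simp
      map_add' := fun x y => by
        change f (monoidCover A (x.1 1 + y.1 1)) - f (monoidCover A (x.1 0 + y.1 0)) = _
        rw [map_add, map_add, map_add, map_add, add_sub_add_comm] }
    (fun x hx => by
      have h := XGroup_apply_mem (p := p) (RingHom.ker (monoidCover A)) hx
      change f (monoidCover A (x.1 1)) - f (monoidCover A (x.1 0)) = 0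
      rw [(RingHom.mem_ker).1 (h 1), (RingHom.mem_ker).1 (h 0), sub_self])

theorem E.diffHom_mk {A : Type u} [Ring A] {G : Type*} [AddCommGroup G] (f : A →+ G)
    (x : X p (MonoidAlgebra ℤ A)) :
    E.diffHom p f (E.mk p A x) = f (monoidCover A (x.1 1)) - f (monoidCover A (x.1 0)) := rfl

theorem E.mk_surjective (A : Type u) [Ring A] : Function.Surjective (E.mk p A) :=
  Ideal.Quotient.mk_surjective

theorem E.continuous_diffHom {A : Type u} [Ring A] {G : Type*} [AddCommGroup G]
    [TopologicalSpace G] [IsTopologicalAddGroup G] (f : A →+ G) :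
    Continuous (E.diffHom p f) := by
  refine continuous_coinduced_dom.2 ?_
  exact ((Seq.continuous_apply (fun r => f (monoidCover A r)) 1).comp
    continuous_subtype_val).sub
    ((Seq.continuous_apply (fun r => f (monoidCover A r)) 0).comp continuous_subtype_val)

/-- The components of `V x` in degrees `0` and `1` are `0` and `p x₀`, and `p` annihilates `G`. -/
theorem E.diffHom_V {A : Type u} [Ring A] {G : Type*} [AddCommGroup G] (f : A →+ G)
    (hG : ∀ g : G, p • g = 0) (x : E p A) : E.diffHom p f (E.V p A x) = 0 := by
  obtain ⟨x, rfl⟩ := E.mk_surjective A x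
  rw [E.V_mk, E.diffHom_mk]
  change f (monoidCover A ((p : MonoidAlgebra ℤ A) * x.1 0)) - f (monoidCover A 0) = 0
  rw [← nsmul_eq_mul, map_nsmul, map_nsmul, hG, map_zero, map_zero, sub_zero]

/-- Multiplication in `X(ℤA)` is componentwise, so the trace property of `f` passes to each of the
two terms. -/
theorem E.diffHom_mul_comm {A : Type u} [Ring A] {G : Type*} [AddCommGroup G] (f : A →+ G)
    (hf : ∀ a b, f (a * b) = f (b * a)) (x y : E p A) :
    E.diffHom p f (x * y) = E.diffHom p f (y * x) := by
  obtain ⟨x, rfl⟩ := E.mk_surjective A x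
  obtain ⟨y, rfl⟩ := E.mk_surjective A y
  rw [← map_mul, ← map_mul, E.diffHom_mk, E.diffHom_mk]
  change f (monoidCover A (x.1 1 * y.1 1)) - f (monoidCover A (x.1 0 * y.1 0)) =
    f (monoidCover A (y.1 1 * x.1 1)) - f (monoidCover A (y.1 0 * x.1 0))
  simp only [map_mul (monoidCover A)]
  rw [hf, hf (monoidCover A (x.1 0))]

theorem monoidCover_of {A : Type u} [Ring A] (a : A) :
    monoidCover A (MonoidAlgebra.of ℤ A a) = a := by
  simp [monoidCover]

theorem E.diffHom_teich {A : Type u} [Ring A] {G : Type*} [AddCommGroup G] (f : A →+ G) (a : A) :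
    E.diffHom p f (E.teich p a) = f (a ^ p) - f a := by
  rw [E.teich, E.diffHom_mk]
  change f (monoidCover A (MonoidAlgebra.of ℤ A a ^ p ^ 1)) -
    f (monoidCover A (MonoidAlgebra.of ℤ A a ^ p ^ 0)) = _
  simp only [map_pow (monoidCover A), monoidCover_of, pow_one, pow_zero]

theorem E.diffHom_teich_mul_teich {A : Type u} [Ring A] {G : Type*} [AddCommGroup G]
    (f : A →+ G) (a b : A) :
    E.diffHom p f (E.teich p a * E.teich p b) = f (a ^ p * b ^ p) - f (a * b) := by
  rw [E.teich, E.teich, ← map_mul, E.diffHom_mk]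
  change f (monoidCover A (MonoidAlgebra.of ℤ A a ^ p ^ 1 * MonoidAlgebra.of ℤ A b ^ p ^ 1)) -
    f (monoidCover A (MonoidAlgebra.of ℤ A a ^ p ^ 0 * MonoidAlgebra.of ℤ A b ^ p ^ 0)) = _
  simp only [map_mul (monoidCover A), map_pow (monoidCover A), monoidCover_of, pow_one, pow_zero]

/-- A continuous homomorphism to a discrete group that is invariant under cyclic permutation of
products factors through `HH₀`. -/
def HH0.lift {R : Type u} [Ring R] [TopologicalSpace R] [IsTopologicalAddGroup R] {G : Type*}
    [AddCommGroup G] [TopologicalSpace G] [T1Space G] (f : R →+ G) (hf : Continuous f)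
    (hcomm : ∀ x y, f (x * y) = f (y * x)) : HH0 R →+ G :=
  QuotientAddGroup.lift _ f (by
    refine AddSubgroup.topologicalClosure_minimal _ ?_ (isClosed_singleton.preimage hf)
    refine (AddSubgroup.closure_le _).2 ?_
    rintro _ ⟨x, y, rfl⟩
    change f (x * y - y * x) = 0
    rw [map_sub, hcomm, sub_self])

theorem HH0.continuous_lift {R : Type u} [Ring R] [TopologicalSpace R] [IsTopologicalAddGroup R]
    {G : Type*} [AddCommGroup G] [TopologicalSpace G] [T1Space G] (f : R →+ G)
    (hf : Continuous f) (hcomm : ∀ x y, f (x * y) = f (y * x)) :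
    Continuous (HH0.lift f hf hcomm) :=
  hf.quotient_lift _

theorem HH0.lift_mk {R : Type u} [Ring R] [TopologicalSpace R] [IsTopologicalAddGroup R]
    {G : Type*} [AddCommGroup G] [TopologicalSpace G] [T1Space G] (f : R →+ G)
    (hf : Continuous f) (hcomm : ∀ x y, f (x * y) = f (y * x)) (x : R) :
    HH0.lift f hf hcomm (HH0.mk R x) = f x := rfl

/-! ### ### A trace modulo `p` on `ℤ{X, Y}` -/

/-- The representation of `ℤ{X, Y}` over `ZMod p` that maps `X` and `Y` to the matrix units
`E₀₁` and `E₁₀`. -/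
def unitRep (p : ℕ) : FreeRing (Fin 2) →+* Matrix (Fin 2) (Fin 2) (ZMod p) :=
  FreeRing.lift ![!![0, 1; 0, 0], !![0, 0; 1, 0]]

/-- The trace of `unitRep`. -/
def unitTrace (p : ℕ) : FreeRing (Fin 2) →+ ZMod p :=
  (Matrix.traceAddMonoidHom (Fin 2) (ZMod p)).comp (unitRep p).toAddMonoidHom

theorem unitTrace_mul_comm (a b : FreeRing (Fin 2)) :
    unitTrace p (a * b) = unitTrace p (b * a) := by
  change (unitRep p (a * b)).trace = (unitRep p (b * a)).trace
  rw [map_mul, map_mul, Matrix.trace_mul_comm]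

/-- Over `𝔽_p` the trace of `M ^ p` is the `p`-th power of the trace of `M`, and Frobenius is the
identity on `𝔽_p`. This makes the functional vanish on every Teichmüller element, and is the reason
for working over the prime field. -/
theorem unitTrace_pow (a : FreeRing (Fin 2)) : unitTrace p (a ^ p) = unitTrace p a := by
  simp [unitTrace, ZMod.trace_pow_card]

/-- `E₀₁ E₁₀ = E₀₀` has trace `1`, whereas the nilpotency `E₀₁ ^ 2 = 0` gives trace `0` for the
higher powers in the next lemma. -/
theorem unitTrace_X_mul_Y :
    unitTrace p (FreeRing.of 0 * FreeRing.of 1) = 1 := by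
  simp [unitTrace, unitRep, Matrix.trace_fin_two]

theorem unitTrace_X_pow_mul_Y_pow {n : ℕ} (hn : 2 ≤ n) :
    unitTrace p (FreeRing.of 0 ^ n * FreeRing.of 1 ^ n) = 0 := by
  have h : (!![0, 1; 0, 0] : Matrix (Fin 2) (Fin 2) (ZMod p)) ^ n = 0 := by
    refine pow_eq_zero_of_le hn ?_
    rw [sq]
    ext i j
    fin_cases i <;> fin_cases j <;> simp [Matrix.mul_apply]
  simp [unitTrace, unitRep, h]

end CuntzDeninger

end NCWitt

open NCWitt

theorem theorem1p1 (p : ℕ) [Fact p.Prime] :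
    ¬ ∃ Φ : NCWitt.HW p (FreeRing (Fin 2)) →+ NCWitt.HH0 (NCWitt.E p (FreeRing (Fin 2))),
      Continuous Φ ∧ Function.Surjective Φ ∧
      (∀ a : FreeRing (Fin 2), Φ (NCWitt.HW.teich p a) = NCWitt.HH0.mk _ (NCWitt.E.teich p a)) ∧
      (∀ w : NCWitt.HW p (FreeRing (Fin 2)), ∃ e : NCWitt.E p (FreeRing (Fin 2)),
        Φ w = NCWitt.HH0.mk _ e ∧
        Φ (NCWitt.HW.verschiebung p (FreeRing (Fin 2)) w) =
          NCWitt.HH0.mk _ (NCWitt.E.V p (FreeRing (Fin 2)) e)) := by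
  rintro ⟨Φ, hΦ, hsurj, hteich, hV⟩
  let _ : TopologicalSpace (ZMod p) := ⊥
  have _ : DiscreteTopology (ZMod p) := ⟨rfl⟩
  have hf := E.continuous_diffHom (p := p) (unitTrace p)
  have hcomm := E.diffHom_mul_comm (p := p) (unitTrace p) unitTrace_mul_comm
  have hzero : (HH0.lift _ hf hcomm).comp Φ = 0 := by
    refine HW.hom_eq_zero _ ((HH0.continuous_lift _ hf hcomm).comp hΦ) (fun a => ?_) fun w => ?_
    · rw [AddMonoidHom.comp_apply, hteich, HH0.lift_mk, E.diffHom_teich, unitTrace_pow, sub_self]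
    -- Only `Φ(V w) = π(V e)` for some `e` matters, since the functional kills `V e` for every `e`.
    · obtain ⟨e, -, he⟩ := hV w
      rw [AddMonoidHom.comp_apply, he, HH0.lift_mk, E.diffHom_V]
      intro g
      rw [nsmul_eq_mul, CharP.cast_eq_zero, zero_mul]
  -- By surjectivity the class of `⟨X⟩⟨Y⟩` comes from some `w`; the functional takes the value `0 -
  -- 1` on it, but the vanishing composite gives `0`.
  obtain ⟨w, hw⟩ := hsurj (HH0.mk _ (E.teich p (FreeRing.of 0) * E.teich p (FreeRing.of 1)))
  have h := DFunLike.congr_fun hzero w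
  rw [AddMonoidHom.comp_apply, hw, HH0.lift_mk, E.diffHom_teich_mul_teich,
    unitTrace_X_pow_mul_Y_pow (Fact.out : p.Prime).two_le, unitTrace_X_mul_Y] at h
  exact neg_ne_zero.2 one_ne_zero (by rwa [zero_sub] at h)
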